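/- Let $X_1,\dots,X_m$ be proper, irreducible, non-elementary $\mathrm{CAT}(-1)$ spaces, where irreducible means not isometric to an $\ell^2$-product of two metric spaces neither of which is a point, and non-elementary means that the boundary at infinity has at least three points. Let $X=\mathbb{E}^n\times\prod_{i=1}^m X_i$ with the $\ell^2$-product metric, and let $H$ be a closed subgroup of $\mathrm{Isom}(\mathbb{E}^n)\times\prod_{i=1}^m\mathrm{Isom}(X_i)$, where isometry groups carry the topology of uniform convergence on compacta. Suppose that $H$ acts on $X$ minimally (the only non-empty closed convex $H$-invariant subset of $X$ is $X$ itself) and cocompactly. Let $\Gamma$ be a uniform $H$-lattice, i.e. a discrete subgroup of $H$ such that $X/\Gamma$ is compact, and suppose that the image of $\Gamma$ under the projection to $\mathrm{O}(n)$ is trivial. Then $\Gamma$ is a hierarchically hyperbolic group. Moreover, $\Gamma$ has a hierarchically hyperbolic group structure which is a product structure in the following sense. There are pairwise distinct, pairwise orthogonal domains, one for each of the $n$ coordinates of $\mathbb{E}^n=\mathbb{R}^n$, whose hyperbolic space is isometric to $\mathbb{R}$, and one for each $i$, whose hyperbolic space is isometric to $X_i$; every other domain has a one-point hyperbolic space.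 The group $\Gamma$ fixes every domain; it acts on the hyperbolic space of the domain of $X_i$ through its projection to $\mathrm{Isom}(X_i)$, and on that of the $j$-th coordinate domain by the translations that it induces on the $j$-th coordinate of $\mathbb{E}^n$. For some $x_0\in X$, the projection of $g\in\Gamma$ to each of these $n+m$ hyperbolic spaces is the corresponding coordinate of $g x_0$. -/

import Mathlib

universe u v w

noncomputable section

namespace HHG


/-! ### Geodesics, hyperbolicity, CAT(-1) spaces -/

/-- `γ` restricted to `[0, dist x y]` is a geodesic from `x` to `y`. -/
def IsGeodesic {Y : Type u} [MetricSpace Y] (γ : ℝ → Y) (x y : Y) : Prop :=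
  γ 0 = x ∧ γ (dist x y) = y ∧
    ∀ s ∈ Set.Icc (0 : ℝ) (dist x y), ∀ t ∈ Set.Icc (0 : ℝ) (dist x y),
      dist (γ s) (γ t) = |s - t|

/-- The image of a geodesic from `x` to `y`. -/
def geodesicImage {Y : Type u} [MetricSpace Y] (γ : ℝ → Y) (x y : Y) : Set Y :=
  γ '' Set.Icc (0 : ℝ) (dist x y)

/-- Any two points are joined by a geodesic. -/
def IsGeodesicSpace (Y : Type u) [MetricSpace Y] : Prop :=
  ∀ x y : Y, ∃ γ : ℝ → Y, IsGeodesic γ x y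

/-- A `δ`-hyperbolic space: a geodesic space all of whose geodesic triangles are `δ`-slim. -/
def IsHyperbolic (δ : ℝ) (Y : Type u) [MetricSpace Y] : Prop :=
  IsGeodesicSpace Y ∧
    ∀ (x y z : Y) (α β γ : ℝ → Y), IsGeodesic α x y → IsGeodesic β y z → IsGeodesic γ x z →
      ∀ a ∈ geodesicImage α x y, ∃ b ∈ geodesicImage β y z ∪ geodesicImage γ x z, dist a b ≤ δ

/-- `x` lies on a geodesic from `p` to `q` (in a geodesic space, this is equivalent to equality
in the triangle inequality). -/
def Between {Y : Type u} [MetricSpace Y] (p x q : Y) : Prop :=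
  dist p x + dist x q = dist p q

/-- `CAT(-1)` spaces: geodesic spaces in which every geodesic triangle is at least as thin as its
comparison triangle in the hyperbolic plane (the upper half plane with its metric of curvature
`-1`). Here `p, q, r` are the vertices, `x` lies on a side `[p, q]` and `y` on a side `[p, r]`;
`p', q', r'` is a comparison triangle and `x', y'` are the comparison points. -/
def IsCATNegOne (Y : Type u) [MetricSpace Y] : Prop :=
  IsGeodesicSpace Y ∧
    ∀ (p q r x y : Y) (p' q' r' x' y' : UpperHalfPlane),
      Between p x q → Between p y r →
      dist p' q' = dist p q → dist p' r' = dist p r → dist q' r' = dist q r →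
      dist p' x' = dist p x → dist x' q' = dist x q →
      dist p' y' = dist p y → dist y' r' = dist y r →
      dist x y ≤ dist x' y'

/-- `r` restricted to `[0, ∞)` is a geodesic ray. -/
def IsGeodesicRay {Y : Type u} [MetricSpace Y] (r : ℝ → Y) : Prop :=
  ∀ s t : ℝ, 0 ≤ s → 0 ≤ t → dist (r s) (r t) = |s - t|

/-- Two rays are asymptotic if they stay at bounded distance, i.e. if they define the same point
of the boundary at infinity. -/
def Asymptotic {Y : Type u} [MetricSpace Y] (r s : ℝ → Y) : Prop :=
  ∃ K : ℝ, ∀ t : ℝ, 0 ≤ t → dist (r t) (s t) ≤ K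

/-- Non-elementary: the boundary at infinity has at least three points. -/
def IsNonElementary (Y : Type u) [MetricSpace Y] : Prop :=
  ∃ r : Fin 3 → ℝ → Y, (∀ k, IsGeodesicRay (r k)) ∧ ∀ k l, k ≠ l → ¬ Asymptotic (r k) (r l)

/-- Irreducible: not isometric to an `ℓ²` product of two metric spaces neither of which is
a point. -/
def IsIrreducible (Y : Type u) [MetricSpace Y] : Prop :=
  ∀ (A B : Type u) [MetricSpace A] [MetricSpace B],
    Nonempty (Y ≃ᵢ WithLp 2 (A × B)) → Subsingleton A ∨ Subsingleton B

/-! ### Isometry groups of products -/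

/-- The topology of uniform convergence on compacta on the isometry group. -/
instance isometryEquivTopology (Y : Type u) [MetricSpace Y] : TopologicalSpace (Y ≃ᵢ Y) :=
  TopologicalSpace.induced (fun f : Y ≃ᵢ Y => (⟨f, f.continuous⟩ : C(Y, Y))) inferInstance

/-- The group `Isom(𝔼ⁿ) × ∏ i, Isom(X i)`. -/
abbrev FactorIsom (n : ℕ) {m : ℕ} (X : Fin m → Type u) [∀ i, MetricSpace (X i)] : Type u :=
  (EuclideanSpace ℝ (Fin n) ≃ᵢ EuclideanSpace ℝ (Fin n)) × (∀ i, X i ≃ᵢ X i)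

/-- The product `𝔼ⁿ × ∏ i, X i` with the `ℓ²` metric. -/
abbrev ProdSpace (n : ℕ) {m : ℕ} (X : Fin m → Type u) [∀ i, MetricSpace (X i)] : Type u :=
  WithLp 2 (EuclideanSpace ℝ (Fin n) × PiLp 2 X)

section
variable {n m : ℕ} {X : Fin m → Type u} [∀ i, MetricSpace (X i)]

/-- The factorwise action of `Isom(𝔼ⁿ) × ∏ i, Isom(X i)` on `𝔼ⁿ × ∏ i, X i`. -/
def act (g : FactorIsom n X) (x : ProdSpace n X) : ProdSpace n X :=
  WithLp.toLp 2 (g.1 x.fst, WithLp.toLp 2 (fun i => g.2 i (x.snd i)))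

/-- `H` acts cocompactly: the translates of some compact set cover the space. (The space being
proper in our setting, this says that the quotient by `H` is compact.) -/
def ActsCocompactly (H : Subgroup (FactorIsom n X)) : Prop :=
  ∃ K : Set (ProdSpace n X), IsCompact K ∧ ∀ x, ∃ h ∈ H, ∃ k ∈ K, act h k = x

/-- `H` acts minimally: the only non-empty `H`-invariant closed convex subset is the whole
space. -/
def ActsMinimally (H : Subgroup (FactorIsom n X)) : Prop :=
  ∀ A : Set (ProdSpace n X), A.Nonempty → IsClosed A →
    (∀ x ∈ A, ∀ y ∈ A, ∀ z, Between x z y → z ∈ A) →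
    (∀ h ∈ H, ∀ x ∈ A, act h x ∈ A) → A = Set.univ

/-- `Γ` is a uniform `H`-lattice: a discrete subgroup of `H` with compact quotient of the
space. -/
structure IsUniformLattice (Γ H : Subgroup (FactorIsom n X)) : Prop where
  le : Γ ≤ H
  discrete : DiscreteTopology Γ
  cocompact : ActsCocompactly Γ

end

/-- The projection `Isom(𝔼ⁿ) = ℝⁿ ⋊ O(n) → O(n)`. -/
def linearPart (n : ℕ) :
    (EuclideanSpace ℝ (Fin n) ≃ᵢ EuclideanSpace ℝ (Fin n)) →*
      (EuclideanSpace ℝ (Fin n) ≃ₗᵢ[ℝ] EuclideanSpace ℝ (Fin n)) where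
  toFun f := f.toRealAffineIsometryEquiv.linearIsometryEquiv
  map_one' := by
    ext1 v
    have h := AffineIsometryEquiv.map_vsub
      (1 : EuclideanSpace ℝ (Fin n) ≃ᵢ EuclideanSpace ℝ (Fin n)).toRealAffineIsometryEquiv v 0
    simpa using h
  map_mul' f g := by
    ext1 v
    have h := AffineIsometryEquiv.map_vsub (f * g).toRealAffineIsometryEquiv v 0
    have h1 := AffineIsometryEquiv.map_vsub g.toRealAffineIsometryEquiv v 0
    have h2 := AffineIsometryEquiv.map_vsub f.toRealAffineIsometryEquiv (g v) (g 0)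
    simp only [vsub_eq_sub, sub_zero, IsometryEquiv.coeFn_toRealAffineIsometryEquiv,
      IsometryEquiv.mul_apply] at h h1 h2
    rw [h, ← h2, ← h1]
    rfl

/-- The projection of `Isom(𝔼ⁿ) × ∏ i, Isom(X i)` to `O(n)`. -/
def projO (n : ℕ) {m : ℕ} (X : Fin m → Type u) [∀ i, MetricSpace (X i)] :
    FactorIsom n X →* (EuclideanSpace ℝ (Fin n) ≃ₗᵢ[ℝ] EuclideanSpace ℝ (Fin n)) :=
  (linearPart n).comp (MonoidHom.fst _ _)

/-! ### Hierarchically hyperbolic spaces -/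

/-- All pairs of points of `A` are at distance at most `r`. -/
def DiamLE {Y : Type u} [MetricSpace Y] (A : Set Y) (r : ℝ) : Prop :=
  ∀ a ∈ A, ∀ b ∈ A, dist a b ≤ r

/-- The distance between two (non-empty) subsets. -/
def setDist {Y : Type u} [MetricSpace Y] (A B : Set Y) : ℝ :=
  sInf (Set.image2 dist A B)

/-- `X` is a `q`-quasigeodesic space: any two points are joined by a `(q, q)`-quasigeodesic. -/
def IsQuasigeodesicSpace (q : ℝ) (X : Type u) [MetricSpace X] : Prop :=
  ∀ x y : X, ∃ (L : ℝ) (f : ℝ → X), 0 ≤ L ∧ f 0 = x ∧ f L = y ∧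
    ∀ s ∈ Set.Icc (0 : ℝ) L, ∀ t ∈ Set.Icc (0 : ℝ) L,
      |s - t| / q - q ≤ dist (f s) (f t) ∧ dist (f s) (f t) ≤ q * |s - t| + q

/-- Two domains are transverse if they are neither orthogonal nor comparable for nesting. -/
def Transverse {ι : Type v} [PartialOrder ι] (Orth : ι → ι → Prop) (V W : ι) : Prop :=
  ¬ Orth V W ∧ ¬ V ≤ W ∧ ¬ W ≤ V

/-- A hierarchically hyperbolic space structure on the metric space `X`. Nesting of domains is
the partial order `≤`. The set `rho V W ⊆ C W` is meaningful when `V < W` or `V` and `W` are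
transverse, and `rhoDown W V : C W → 2^(C V)` is meaningful when `V < W`. -/
structure HHSStructure (X : Type u) [MetricSpace X] where
  /-- the set of domains -/
  Index : Type v
  /-- the hyperbolic space of a domain -/
  C : Index → Type w
  [metric : ∀ W, MetricSpace (C W)]
  /-- nesting -/
  [nest : PartialOrder Index]
  /-- orthogonality -/
  Orth : Index → Index → Prop
  /-- the projections -/
  proj : ∀ W, X → Set (C W)
  /-- the relative projections `ρ^V_W` -/
  rho : ∀ (_V W : Index), Set (C W)
  /-- the relative projections `ρ^W_V` for `V` properly nested in `W` -/
  rhoDown : ∀ W V : Index, C W → Set (C V)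
  /-- bound on the diameters of projections -/
  ξ : ℝ
  /-- consistency constant -/
  κ₀ : ℝ
  -- the underlying space and the hyperbolic spaces
  quasigeodesic : ∃ q : ℝ, 1 ≤ q ∧ IsQuasigeodesicSpace q X
  hyperbolic : ∃ δ : ℝ, ∀ W, IsHyperbolic δ (C W)
  -- projections
  proj_nonempty : ∀ W x, (proj W x).Nonempty
  proj_diam : ∀ W x, DiamLE (proj W x) ξ
  proj_lipschitz_onto : ∃ K : ℝ, ∀ W,
    (∀ x y, setDist (proj W x) (proj W y) ≤ K * dist x y + K) ∧
    (∀ p : C W, ∃ x, ∃ a ∈ proj W x, dist p a ≤ K)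
  -- nesting
  unique_maximal : IsEmpty Index ∨ ∃! S : Index, ∀ V, S ≤ V → V = S
  rho_nonempty : ∀ V W, (V < W ∨ Transverse Orth V W) → (rho V W).Nonempty
  rho_diam : ∀ V W, (V < W ∨ Transverse Orth V W) → DiamLE (rho V W) ξ
  rhoDown_nonempty : ∀ V W, V < W → ∀ p, (rhoDown W V p).Nonempty
  -- orthogonality
  orth_symm : ∀ V W, Orth V W → Orth W V
  orth_irrefl : ∀ V, ¬ Orth V V
  orth_of_le : ∀ U V W, V ≤ W → Orth W U → Orth V U
  orth_not_le : ∀ V W, Orth V W → ¬ V ≤ W ∧ ¬ W ≤ V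
  orth_container : ∀ T U, U ≤ T → (∃ V ≤ T, Orth V U) →
    ∃ W < T, ∀ V ≤ T, Orth V U → V ≤ W
  -- transversality and consistency
  consistency_transverse : ∀ V W, Transverse Orth V W → ∀ x,
    setDist (proj W x) (rho V W) ≤ κ₀ ∨ setDist (proj V x) (rho W V) ≤ κ₀
  consistency_nest : ∀ V W, V < W → ∀ x,
    setDist (proj W x) (rho V W) ≤ κ₀ ∨
      DiamLE (proj V x ∪ ⋃ p ∈ proj W x, rhoDown W V p) κ₀
  consistency_rho : ∀ U V W, U ≤ V → (V < W ∨ (Transverse Orth V W ∧ ¬ Orth W U)) →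
    setDist (rho U W) (rho V W) ≤ κ₀
  -- finite complexity
  finite_complexity : ∃ N : ℕ, ∀ s : Finset Index,
    IsChain (fun V W => V ≤ W) (s : Set Index) → s.card ≤ N
  -- large links
  large_links : ∃ lam E : ℝ, 1 ≤ lam ∧ ξ ≤ E ∧ κ₀ ≤ E ∧ ∀ W x x',
    ∃ T : Finset Index,
      (T.card : ℝ) ≤ lam * setDist (proj W x) (proj W x') + lam ∧
      (∀ U ∈ T, U < W ∧
        setDist (proj W x) (rho U W) ≤ lam * setDist (proj W x) (proj W x') + lam) ∧
      ∀ V, V < W → (∃ U ∈ T, V ≤ U) ∨ setDist (proj V x) (proj V x') < E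
  -- bounded geodesic image
  bounded_geodesic_image : ∃ E : ℝ, 0 < E ∧ ∀ V W, V < W →
    ∀ (p q : C W) (γ : ℝ → C W), IsGeodesic γ p q →
      DiamLE (⋃ a ∈ geodesicImage γ p q, rhoDown W V a) E ∨
        ∃ a ∈ geodesicImage γ p q, ∃ b ∈ rho V W, dist a b ≤ E
  -- partial realization
  partial_realization : ∃ α : ℝ, ∀ (𝒱 : Set Index) (p : ∀ V : 𝒱, C V.1),
    𝒱.Pairwise Orth → (∀ V : 𝒱, ∃ y, p V ∈ proj V.1 y) →
    ∃ x, ∀ V : 𝒱, setDist (proj V.1 x) {p V} ≤ α ∧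
      ∀ W, (V.1 < W ∨ Transverse Orth W V.1) → setDist (proj W x) (rho V.1 W) ≤ α
  -- uniqueness
  uniqueness : ∀ κ : ℝ, 0 ≤ κ → ∃ θ : ℝ, ∀ x y, θ ≤ dist x y →
    ∃ V, κ ≤ setDist (proj V x) (proj V y)

attribute [instance] HHSStructure.metric HHSStructure.nest

/-! ### Hierarchically hyperbolic groups -/

theorem mulCayley_connected {G : Type u} [Group G] (A : Set G) (hA : Subgroup.closure A = ⊤) :
    (SimpleGraph.mulCayley A).Connected := by
  have key : ∀ g : G, g ∈ Subgroup.closure A →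
      ∀ h : G, (SimpleGraph.mulCayley A).Reachable h (h * g) := by
    intro g hg
    induction hg using Subgroup.closure_induction with
    | mem a ha =>
      intro h
      by_cases e : h = h * a
      · rw [← e]
      · exact SimpleGraph.Adj.reachable
          ((SimpleGraph.mulCayley_adj A h (h * a)).2 ⟨e, Or.inl (by simpa using ha)⟩)
    | one => intro h; rw [mul_one]
    | mul a b _ _ iha ihb =>
      intro h
      have := (iha h).trans (ihb (h * a))
      rwa [mul_assoc] at this
    | inv a _ iha =>
      intro h
      have := (iha (h * a⁻¹)).symm
      rwa [inv_mul_cancel_right] at this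
  refine ⟨fun x y => ?_⟩
  have := key (x⁻¹ * y) (by rw [hA]; trivial) x
  rwa [mul_inv_cancel_left] at this

/-- The word metric, i.e. the graph metric on the vertices of the Cayley graph. -/
@[reducible] def wordMetric {G : Type u} [Group G] (A : Set G)
    (hA : Subgroup.closure A = ⊤) : MetricSpace G where
  dist g h := ((SimpleGraph.mulCayley A).dist g h : ℝ)
  dist_self g := by simp
  dist_comm g h := by rw [SimpleGraph.dist_comm]
  dist_triangle g h k := by exact_mod_cast (mulCayley_connected A hA).dist_triangle
  eq_of_dist_eq_zero {g h} e :=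
    (mulCayley_connected A hA).dist_eq_zero_iff.1 (by exact_mod_cast e)

/-- The group `G` regarded as the vertex set of its Cayley graph for the generating set `A`. -/
def Cayley {G : Type u} [Group G] (A : Set G) (_hA : Subgroup.closure A = ⊤) : Type u := G

/-- The vertex of the Cayley graph given by a group element. -/
def Cayley.vertex {G : Type u} [Group G] (A : Set G) (hA : Subgroup.closure A = ⊤) (g : G) :
    Cayley A hA := g

/-- The word metric is the metric on the vertices of the Cayley graph. -/
instance {G : Type u} [Group G] (A : Set G) (hA : Subgroup.closure A = ⊤) :
    MetricSpace (Cayley A hA) := wordMetric (G := G) A hA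

/-- A hierarchically hyperbolic group structure on `G`. -/
structure HHGStructure (G : Type u) [Group G] where
  /-- a finite generating set -/
  gens : Set G
  gens_finite : gens.Finite
  gens_generate : Subgroup.closure gens = ⊤
  /-- the HHS structure on the Cayley graph -/
  hhs : HHSStructure.{u, v, w} (Cayley gens gens_generate)
  /-- the action on the set of domains -/
  [action : MulAction G hhs.Index]
  cofinite : Finite (MulAction.orbitRel.Quotient G hhs.Index)
  smul_le_iff : ∀ (g : G) (V W : hhs.Index), g • V ≤ g • W ↔ V ≤ W
  smul_orth_iff : ∀ (g : G) (V W : hhs.Index), hhs.Orth (g • V) (g • W) ↔ hhs.Orth V W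
  /-- the isometries between the hyperbolic spaces -/
  isom : ∀ (g : G) (U : hhs.Index), hhs.C U ≃ᵢ hhs.C (g • U)
  isom_mul : ∀ (g h : G) (U : hhs.Index) (p : hhs.C U),
    HEq (isom (g * h) U p) (isom g (h • U) (isom h U p))
  proj_equivariant : ∀ (g x : G) (U : hhs.Index),
    isom g U '' hhs.proj U (Cayley.vertex gens gens_generate x) =
      hhs.proj (g • U) (Cayley.vertex gens gens_generate (g * x))
  rho_equivariant : ∀ (g : G) (V U : hhs.Index), (V < U ∨ Transverse hhs.Orth V U) →
    isom g U '' hhs.rho V U = hhs.rho (g • V) (g • U)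

attribute [instance] HHGStructure.action

/-- The projection of a group element to the hyperbolic space of a domain. -/
def HHGStructure.projection {G : Type u} [Group G] (S : HHGStructure.{u, v, w} G)
    (U : S.hhs.Index) (g : G) : Set (S.hhs.C U) :=
  S.hhs.proj U (Cayley.vertex S.gens S.gens_generate g)

/-- The HHG structure `S` on `Γ` is the product structure: up to isometry the domains are one copy
of `ℝ` for each coordinate of `𝔼ⁿ` and one copy of each `X i`, these being pairwise orthogonal and
distinct, and all other domains are points; `Γ` fixes every domain and acts on the copy of `ℝ`,
respectively `X i`, through its action by translations on that coordinate, respectively through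
its projection to `Isom(X i)`; and the projections are the coordinates of an orbit map. -/
def IsProductStructure {n m : ℕ} {X : Fin m → Type u} [∀ i, MetricSpace (X i)]
    {Γ : Subgroup (FactorIsom n X)} (S : HHGStructure.{u, v, w} Γ) : Prop :=
  ∃ (dom : Fin n ⊕ Fin m → S.hhs.Index) (x₀ : ProdSpace n X)
    (eR : ∀ j : Fin n, ℝ ≃ᵢ S.hhs.C (dom (Sum.inl j)))
    (eX : ∀ i : Fin m, X i ≃ᵢ S.hhs.C (dom (Sum.inr i))),
    Function.Injective dom ∧
    (∀ k l, k ≠ l → S.hhs.Orth (dom k) (dom l)) ∧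
    (∀ U, U ∉ Set.range dom → ∃ p : S.hhs.C U, ∀ q, q = p) ∧
    (∀ (g : Γ) (U : S.hhs.Index), g • U = U) ∧
    (∀ (g : Γ) (j : Fin n) (t : ℝ),
      HEq (S.isom g (dom (Sum.inl j)) (eR j t)) (eR j (t + (g.1.1 0) j))) ∧
    (∀ (g : Γ) (i : Fin m) (p : X i),
      HEq (S.isom g (dom (Sum.inr i)) (eX i p)) (eX i (g.1.2 i p))) ∧
    (∀ (g : Γ) (j : Fin n),
      S.projection (dom (Sum.inl j)) g = {eR j ((act g.1 x₀).fst j)}) ∧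
    (∀ (g : Γ) (i : Fin m),
      S.projection (dom (Sum.inr i)) g = {eX i ((act g.1 x₀).snd i)})

end HHG

end

/-!
All the factors of `𝔼ⁿ × ∏ i, X i` are hyperbolic once `𝔼ⁿ` is split into its `n` coordinate lines:
a `CAT(-1)` space is `1`-hyperbolic (`IsCATNegOne.isHyperbolic`), by a computation with the
hyperbolic law of cosines in the comparison triangle. Since `Γ` has trivial image in `O(n)`, it acts
on `𝔼ⁿ` by translations, so it acts on every coordinate line as well as on every `X i`
(`factorAction`). Thus `Γ` acts factorwise on a product of `n + m` hyperbolic spaces.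

The action is cobounded because `Γ` is cocompact, and proper because `Γ` is discrete
(`finite_of_discrete`; by pigeonhole, an infinite set of elements of bounded displacement would
contain two whose quotient is arbitrarily close to the identity). By the Milnor–Schwarz argument
(`closure_shortElements_eq_top`, `mulCayley_dist_le`, `dist_orbit_le`), the elements of displacement
at most a suitable constant form a finite generating set, and the orbit map is a quasi-isometry from
the Cayley graph to the product.

A space quasi-isometric to a product of finitely many hyperbolic spaces has a hierarchically
hyperbolic structure (`productHHS`) whose domains are the non-empty sets of factors, nested by
inclusion and orthogonal when disjoint; a singleton carries the factor, and every other domain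
carries a point. The relative projection of `V` to `W` is a subset of the space of a domain `W` with
at least two factors, which is a point; this disposes of consistency, large links and bounded
geodesic image, whatever the maps from the space of `W` back to that of `V` are.
Partial realization is coboundedness of the orbit, and uniqueness is properness of the orbit map.
As `Γ` preserves each factor, it acts trivially on the set of domains (`productHHG`).
-/

noncomputable section

namespace HHG

/-! ### Hyperbolicity of `CAT(-1)` spaces -/

/-- Points at equal distance from a vertex of a triangle, on the two sides issuing from that vertex
and no farther than the Gromov product of the opposite vertices, are `δ`-close: triangles are
`δ`-thin. -/
def HasThinTriangles (δ : ℝ) (Y : Type u) [MetricSpace Y] : Prop :=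
  ∀ p q r x y : Y, Between p x q → Between p y r → dist p x = dist p y →
    2 * dist p x ≤ dist p q + dist p r - dist q r → dist x y ≤ δ

theorem IsGeodesic.dist_left {Y : Type u} [MetricSpace Y] {γ : ℝ → Y} {x y : Y}
    (h : IsGeodesic γ x y) {s : ℝ} (hs : s ∈ Set.Icc 0 (dist x y)) : dist x (γ s) = s := by
  have := h.2.2 0 ⟨le_rfl, dist_nonneg⟩ s hs
  rwa [h.1, zero_sub, abs_neg, abs_of_nonneg hs.1] at this

theorem IsGeodesic.dist_right {Y : Type u} [MetricSpace Y] {γ : ℝ → Y} {x y : Y}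
    (h : IsGeodesic γ x y) {s : ℝ} (hs : s ∈ Set.Icc 0 (dist x y)) :
    dist (γ s) y = dist x y - s := by
  have := h.2.2 s hs (dist x y) ⟨dist_nonneg, le_rfl⟩
  rwa [h.2.1, abs_sub_comm, abs_of_nonneg (sub_nonneg.2 hs.2)] at this

theorem IsGeodesic.between {Y : Type u} [MetricSpace Y] {γ : ℝ → Y} {x y : Y}
    (h : IsGeodesic γ x y) {s : ℝ} (hs : s ∈ Set.Icc 0 (dist x y)) : Between x (γ s) y := by
  rw [Between, h.dist_left hs, h.dist_right hs]
  ring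

theorem isHyperbolic_of_hasThinTriangles {δ : ℝ} {Y : Type u} [MetricSpace Y]
    (hY : IsGeodesicSpace Y) (h : HasThinTriangles δ Y) : IsHyperbolic δ Y := by
  refine ⟨hY, ?_⟩
  rintro x y z α β γ hα hβ hγ _ ⟨s, hs, rfl⟩
  -- Every point of the side `[x, y]` is within the Gromov product of one of its endpoints.
  rcases le_total (2 * s) (dist x y + dist x z - dist y z) with hc | hc
  · have hs' : s ∈ Set.Icc 0 (dist x z) := by
      have := dist_triangle x z y
      rw [dist_comm z y] at this
      exact ⟨hs.1, by linarith⟩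
    refine ⟨γ s, Or.inr ⟨s, hs', rfl⟩, h x y z _ _ (hα.between hs) (hγ.between hs') ?_ ?_⟩
    · rw [hα.dist_left hs, hγ.dist_left hs']
    · rwa [hα.dist_left hs]
  · have ht : dist x y - s ∈ Set.Icc 0 (dist y z) := by
      have := dist_triangle x z y
      rw [dist_comm z y] at this
      exact ⟨by linarith [hs.2], by linarith⟩
    refine ⟨β (dist x y - s), Or.inl ⟨_, ht, rfl⟩,
      h y x z _ _ ?_ (hβ.between ht) ?_ ?_⟩
    · have := hα.between hs
      rw [Between] at this ⊢
      rw [dist_comm y, dist_comm (α s) x, dist_comm y x, add_comm, this]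
    · rw [dist_comm y, hα.dist_right hs, hβ.dist_left ht]
    · rw [dist_comm y, hα.dist_right hs, dist_comm y x]
      linarith

/-- The point of the upper half plane with coordinates `(T, a, b)` in the hyperboloid model
`T ^ 2 = 1 + a ^ 2 + b ^ 2`, `0 < T`. -/
def ofHyperboloid (T a b : ℝ) (h : a < T) : UpperHalfPlane :=
  ⟨⟨b / (T - a), 1 / (T - a)⟩, one_div_pos.2 (sub_pos.2 h)⟩

open Real in
/-- In the hyperboloid model, `cosh` of the distance is the Lorentz form. -/
theorem cosh_dist_ofHyperboloid {T a b T' a' b' : ℝ} (h : a < T) (h' : a' < T')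
    (e : T ^ 2 = 1 + a ^ 2 + b ^ 2) (e' : T' ^ 2 = 1 + a' ^ 2 + b' ^ 2) :
    cosh (dist (ofHyperboloid T a b h) (ofHyperboloid T' a' b' h')) =
      T * T' - a * a' - b * b' := by
  have h1 : T - a ≠ 0 := (sub_pos.2 h).ne'
  have h2 : T' - a' ≠ 0 := (sub_pos.2 h').ne'
  rw [UpperHalfPlane.cosh_dist']
  simp only [ofHyperboloid, UpperHalfPlane.re, UpperHalfPlane.im]
  field_simp
  have e1 : b ^ 2 = (T - a) * (T + a) - 1 := by linarith
  have e2 : b' ^ 2 = (T' - a') * (T' + a') - 1 := by linarith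
  linear_combination (T' - a') ^ 2 * e1 + (T - a) ^ 2 * e2

open Real in
/-- The point of the hyperbolic plane with polar coordinates `(s, θ)`, where `c = cos θ` and
`d = sin θ`. -/
def polar (s c d : ℝ) (h : c ^ 2 + d ^ 2 = 1) : UpperHalfPlane :=
  ofHyperboloid (cosh s) (sinh s * c) (sinh s * d) (by
    refine lt_of_abs_lt (abs_lt_of_sq_lt_sq ?_ (cosh_pos s).le)
    rw [cosh_sq]
    nlinarith [sq_nonneg (sinh s * d), congrArg (sinh s ^ 2 * ·) h])

open Real in
/-- The hyperbolic law of cosines. -/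
theorem cosh_dist_polar {s c d s' c' d' : ℝ} (h : c ^ 2 + d ^ 2 = 1) (h' : c' ^ 2 + d' ^ 2 = 1) :
    cosh (dist (polar s c d h) (polar s' c' d' h')) =
      cosh s * cosh s' - sinh s * sinh s' * (c * c' + d * d') := by
  rw [polar, polar, cosh_dist_ofHyperboloid]
  · ring
  · rw [cosh_sq]; linear_combination -(sinh s ^ 2 * h)
  · rw [cosh_sq]; linear_combination -(sinh s' ^ 2 * h')

open Real in
theorem dist_polar_same {s s' c d : ℝ} (h : c ^ 2 + d ^ 2 = 1) :
    dist (polar s c d h) (polar s' c d h) = |s - s'| := by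
  refine cosh_strictMonoOn.injOn (Set.mem_Ici.2 dist_nonneg) (Set.mem_Ici.2 (abs_nonneg _)) ?_
  rw [cosh_dist_polar, cosh_abs, cosh_sub]
  linear_combination -(sinh s * sinh s' * h)

open Real in
theorem two_mul_sinh_mul_sinh (x y : ℝ) :
    2 * (sinh x * sinh y) = cosh (x + y) - cosh (x - y) := by
  rw [cosh_add, cosh_sub]; ring

open Real in
theorem two_mul_sinh_mul_sinh_sub_le {s a : ℝ} (ha : 0 ≤ a) :
    2 * (sinh s * sinh (a - s)) ≤ sinh a := by
  rw [two_mul_sinh_mul_sinh, add_sub_cancel]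
  have := one_le_cosh (s - (a - s))
  have := exp_le_one_iff.2 (neg_nonpos.2 ha)
  have := cosh_sub_sinh a
  linarith

open Real in
/-- A `CAT(-1)` space has `1`-thin triangles. In the comparison triangle with sides `a`, `b` at
angle `θ` opposite to `c`, the law of cosines bounds the distance `d` of the comparison points at
distance `s` from the vertex by
`cosh d - 1 ≤ 2 * (sinh s * sinh (a - s) / sinh a) * (sinh s * sinh (b - s) / sinh b) ≤ 1 / 2`. -/
theorem IsCATNegOne.hasThinTriangles {Y : Type u} [MetricSpace Y] (h : IsCATNegOne Y) :
    HasThinTriangles 1 Y := by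
  intro p q r x y hx hy hxy hs
  obtain ⟨s, hs_def⟩ : ∃ s, s = dist p x := ⟨_, rfl⟩
  obtain ⟨a, ha_def⟩ : ∃ a, a = dist p q := ⟨_, rfl⟩
  obtain ⟨b, hb_def⟩ : ∃ b, b = dist p r := ⟨_, rfl⟩
  obtain ⟨c, hc_def⟩ : ∃ c, c = dist q r := ⟨_, rfl⟩
  have hs0 : 0 ≤ s := hs_def ▸ dist_nonneg
  have hc0 : 0 ≤ c := hc_def ▸ dist_nonneg
  have hac : a ≤ b + c := by
    have := dist_triangle p r q; rw [dist_comm r q] at this; linarith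
  have hbc : b ≤ a + c := by have := dist_triangle p q r; linarith
  have hcab : c ≤ a + b := by
    have := dist_triangle q p r; rw [dist_comm q p] at this; linarith
  rcases hs0.eq_or_lt with hs0 | hs0
  · -- Both points are the vertex `p`.
    have h1 : p = x := dist_eq_zero.1 (by rw [← hs_def, hs0])
    have h2 : p = y := dist_eq_zero.1 (by rw [← hxy, ← hs_def, hs0])
    rw [← h1, ← h2, dist_self]
    exact zero_le_one
  have hsa : s ≤ a := by linarith
  have hsb : s ≤ b := by linarith
  have ha := sinh_pos_iff.2 (hs0.trans_le hsa)
  have hb := sinh_pos_iff.2 (hs0.trans_le hsb)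
  have hab := mul_pos ha hb
  -- The cosine of the angle of the comparison triangle at the vertex `p`.
  obtain ⟨k, hk⟩ : ∃ k, k = (cosh a * cosh b - cosh c) / (sinh a * sinh b) := ⟨_, rfl⟩
  have hk' : sinh a * sinh b * k = cosh a * cosh b - cosh c := by
    rw [hk]; field_simp
  have hk1 : k ≤ 1 := by
    have : cosh (a - b) ≤ cosh c := cosh_le_cosh.2 (by
      rw [abs_of_nonneg hc0, abs_le]; constructor <;> linarith)
    rw [cosh_sub] at this
    rw [hk, div_le_one hab]
    linarith
  have hk2 : -1 ≤ k := by
    have : cosh c ≤ cosh (a + b) := cosh_le_cosh.2 (by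
      rw [abs_of_nonneg hc0, abs_of_nonneg (by linarith)]; exact hcab)
    rw [cosh_add] at this
    rw [hk, le_div_iff₀ hab]
    linarith
  have h10 : (1 : ℝ) ^ 2 + 0 ^ 2 = 1 := by norm_num
  have hkk : k ^ 2 + (√(1 - k ^ 2)) ^ 2 = 1 := by
    rw [sq_sqrt (by nlinarith)]; ring
  have key := h.2 p q r x y (polar 0 1 0 h10) (polar a 1 0 h10) (polar b k _ hkk)
    (polar s 1 0 h10) (polar s k _ hkk) hx hy
  have e0 : polar 0 1 0 h10 = polar 0 k _ hkk := by simp [polar]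
  have hd := key
    (by rw [dist_polar_same, zero_sub, abs_neg, abs_of_nonneg (by linarith), ha_def])
    (by rw [e0, dist_polar_same, zero_sub, abs_neg, abs_of_nonneg (by linarith), hb_def])
    (by
      refine cosh_strictMonoOn.injOn (Set.mem_Ici.2 dist_nonneg) (Set.mem_Ici.2 dist_nonneg) ?_
      rw [cosh_dist_polar, ← hc_def]
      linear_combination -hk')
    (by rw [dist_polar_same, zero_sub, abs_neg, abs_of_nonneg hs0.le, hs_def])
    (by
      rw [Between, ← hs_def, ← ha_def] at hx
      rw [dist_polar_same, abs_sub_comm, abs_of_nonneg (by linarith)]; linarith)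
    (by rw [e0, dist_polar_same, zero_sub, abs_neg, abs_of_nonneg hs0.le, hs_def, hxy])
    (by
      rw [Between, ← hxy, ← hs_def, ← hb_def] at hy
      rw [dist_polar_same, abs_sub_comm, abs_of_nonneg (by linarith)]; linarith)
  refine hd.trans ?_
  set d := dist (polar s 1 0 h10) (polar s k _ hkk) with hd_def
  have hd0 : 0 ≤ d := dist_nonneg
  have ed : cosh d - 1 = sinh s ^ 2 * (1 - k) := by
    rw [hd_def, cosh_dist_polar]
    have := cosh_sq s
    linear_combination this
  have e1 : sinh a * sinh b * (1 - k) ≤ 2 * (sinh (a - s) * sinh (b - s)) := by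
    have : cosh c ≤ cosh (a - s + (b - s)) := cosh_le_cosh.2 (by
      rw [abs_of_nonneg hc0, abs_of_nonneg (by linarith)]; linarith)
    rw [two_mul_sinh_mul_sinh, show a - s - (b - s) = a - b by ring, cosh_sub a b]
    linarith
  have e2 : sinh a * sinh b * (cosh d - 1) ≤ sinh a * sinh b * (1 / 2) := by
    have f1 := two_mul_sinh_mul_sinh_sub_le (s := s) (hs0.le.trans hsa)
    have f2 := two_mul_sinh_mul_sinh_sub_le (s := s) (hs0.le.trans hsb)
    have g1 : 0 ≤ sinh s := sinh_nonneg_iff.2 hs0.le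
    have g2 : 0 ≤ sinh (b - s) := sinh_nonneg_iff.2 (sub_nonneg.2 hsb)
    have := mul_le_mul f1 f2 (by positivity) ha.le
    have := mul_le_mul_of_nonneg_left e1 (sq_nonneg (sinh s))
    rw [ed]
    nlinarith
  have e3 : cosh d ≤ 3 / 2 := by linarith [le_of_mul_le_mul_left e2 hab]
  have e4 : 3 / 2 ≤ cosh 1 := by
    rw [cosh_eq]
    linarith [exp_one_gt_d9, exp_neg_one_gt_d9]
  have := cosh_le_cosh.1 (e3.trans e4)
  rwa [abs_of_nonneg hd0, abs_one] at this

theorem IsCATNegOne.isHyperbolic {Y : Type u} [MetricSpace Y] (h : IsCATNegOne Y) :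
    IsHyperbolic 1 Y :=
  isHyperbolic_of_hasThinTriangles h.1 h.hasThinTriangles

theorem isHyperbolic_real : IsHyperbolic 1 (ULift.{u} ℝ) := by
  refine isHyperbolic_of_hasThinTriangles ?_ ?_
  · rintro ⟨x⟩ ⟨y⟩
    rcases le_total x y with h | h
    · refine ⟨fun t => ⟨x + t⟩, ?_, ?_, fun s _ t _ => ?_⟩
      · simp
      · ext; change x + |x - y| = y
        rw [abs_sub_comm, abs_of_nonneg (sub_nonneg.2 h)]; ring
      · change |x + s - (x + t)| = _
        congr 1; ring
    · refine ⟨fun t => ⟨x - t⟩, ?_, ?_, fun s _ t _ => ?_⟩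
      · simp
      · ext; change x - |x - y| = y
        rw [abs_of_nonneg (sub_nonneg.2 h)]; ring
      · change |x - s - (x - t)| = _
        rw [abs_sub_comm s]
        congr 1; ring
  · rintro ⟨p⟩ ⟨q⟩ ⟨r⟩ ⟨x⟩ ⟨y⟩ hx hy hxy hs
    change |p - x| + |x - q| = |p - q| at hx
    change |p - y| + |y - r| = |p - r| at hy
    change |p - x| = |p - y| at hxy
    change 2 * |p - x| ≤ |p - q| + |p - r| - |q - r| at hs
    change |x - y| ≤ 1
    grind

theorem isHyperbolic_of_subsingleton {Y : Type u} [MetricSpace Y] [Subsingleton Y] :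
    IsHyperbolic 1 Y :=
  isHyperbolic_of_hasThinTriangles
    (fun x y => ⟨fun _ => x, rfl, Subsingleton.elim _ _, fun s hs t ht => by
      rw [dist_eq_zero.2 (Subsingleton.elim x y), Set.Icc_self, Set.mem_singleton_iff] at hs ht
      simp [hs, ht]⟩)
    (fun p q r x y _ _ _ _ => by
      rw [Subsingleton.elim x y, dist_self]; exact zero_le_one)

/-! ### The hierarchically hyperbolic structure of a product of hyperbolic spaces -/

/-- The domains of a product of spaces indexed by `ι`: they stand for the non-empty subsets of `ι`,
but the singletons, which carry the factors, are kept apart from the subsets with at least two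
elements, which carry points. This makes the hyperbolic space of a factor definitionally equal to
that factor. -/
inductive ProductDomain (ι : Type v) : Type v
  /-- the domain that carries the factor `i` -/
  | factor (i : ι) : ProductDomain ι
  /-- a set of at least two factors -/
  | multiple (s : Set ι) (hs : s.Nontrivial) : ProductDomain ι

namespace ProductDomain

variable {ι : Type v}

/-- The set of factors involved in a domain. -/
def support : ProductDomain ι → Set ι
  | factor i => {i}
  | multiple s _ => s

theorem support_nonempty : ∀ V : ProductDomain ι, V.support.Nonempty
  | factor i => Set.singleton_nonempty i
  | multiple _ hs => hs.nonempty

theorem support_injective : Function.Injective (support : ProductDomain ι → Set ι) := by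
  rintro (i | ⟨s, hs⟩) (j | ⟨t, ht⟩) h
  · exact congrArg factor (Set.singleton_injective h)
  · exact absurd ht (by rw [← show ({i} : Set ι) = t from h]; exact Set.not_nontrivial_singleton)
  · exact absurd hs (by rw [show s = {j} from h]; exact Set.not_nontrivial_singleton)
  · obtain rfl : s = t := h
    rfl

theorem exists_support_eq {s : Set ι} (hs : s.Nonempty) : ∃ V : ProductDomain ι, V.support = s := by
  rcases hs.exists_eq_singleton_or_nontrivial with ⟨i, rfl⟩ | h
  · exact ⟨factor i, rfl⟩
  · exact ⟨multiple s h, rfl⟩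

/-- Nesting of domains is inclusion of their supports. -/
instance : PartialOrder (ProductDomain ι) := PartialOrder.lift support support_injective

theorem le_def {V W : ProductDomain ι} : V ≤ W ↔ V.support ⊆ W.support := Iff.rfl

theorem lt_def {V W : ProductDomain ι} : V < W ↔ V.support ⊂ W.support := Iff.rfl

instance [Finite ι] : Finite (ProductDomain ι) := Finite.of_injective _ support_injective

/-- Domains are orthogonal if they involve no common factor. -/
def Orth (V W : ProductDomain ι) : Prop := Disjoint V.support W.support

/-- The hyperbolic space of a domain: the factor for a singleton, a point otherwise. -/
def Space (Y : ι → Type w) : ProductDomain ι → Type w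
  | factor i => Y i
  | multiple _ _ => PUnit

instance (Y : ι → Type w) [∀ i, MetricSpace (Y i)] : ∀ V, MetricSpace (Space Y V)
  | factor i => inferInstanceAs (MetricSpace (Y i))
  | multiple _ _ => inferInstanceAs (MetricSpace PUnit)

instance (Y : ι → Type w) [∀ i, Nonempty (Y i)] : ∀ V, Nonempty (Space Y V)
  | factor i => inferInstanceAs (Nonempty (Y i))
  | multiple _ _ => inferInstanceAs (Nonempty PUnit)

/-- The image of a point of the product in the hyperbolic space of a domain. -/
def coord {Y : ι → Type w} (y : ∀ i, Y i) : ∀ V, Space Y V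
  | factor i => y i
  | multiple _ _ => PUnit.unit

/-- A domain in which some domain is properly nested, or which is transverse to some domain, has at
least two factors, so that its hyperbolic space is a point. This makes the axioms on relative
projections trivial. -/
theorem subsingleton_space (Y : ι → Type w) {V W : ProductDomain ι}
    (h : V < W ∨ Transverse Orth V W) : Subsingleton (Space Y W) := by
  obtain i | ⟨s, hs⟩ := W
  · exfalso
    rcases h with h | h
    · rw [lt_def] at h
      exact V.support_nonempty.ne_empty (Set.ssubset_singleton_iff.1 h)
    · exact h.1 (Set.disjoint_singleton_right.2 fun hi => h.2.2 (Set.singleton_subset_iff.2 hi))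
  · exact inferInstanceAs (Subsingleton PUnit)

theorem transverse_comm {V W : ProductDomain ι} : Transverse Orth V W ↔ Transverse Orth W V := by
  simp only [Transverse, Orth, disjoint_comm]
  tauto

end ProductDomain

theorem setDist_singleton {Y : Type u} [MetricSpace Y] (a b : Y) : setDist {a} {b} = dist a b := by
  simp [setDist]

theorem setDist_of_subsingleton {Y : Type u} [MetricSpace Y] [Subsingleton Y] (A B : Set Y) :
    setDist A B = 0 := by
  have h : Set.image2 dist A B ⊆ {0} := by
    rintro _ ⟨a, _, b, _, rfl⟩
    exact dist_eq_zero.2 (Subsingleton.elim a b)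
  rcases Set.subset_singleton_iff_eq.1 h with h | h <;> simp [setDist, h]

theorem diamLE_of_subsingleton {Y : Type u} [MetricSpace Y] [Subsingleton Y] (A : Set Y) :
    DiamLE A 0 :=
  fun a _ b _ => (dist_eq_zero.2 (Subsingleton.elim a b)).le

theorem setDist_nonneg {Y : Type u} [MetricSpace Y] (A B : Set Y) : 0 ≤ setDist A B :=
  Real.sInf_nonneg (by rintro _ ⟨a, _, b, _, rfl⟩; exact dist_nonneg)

open ProductDomain in
/-- The hierarchically hyperbolic structure on a space `Z` with a quasi-isometry `f` to the product
of finitely many hyperbolic spaces. Every relative projection is the whole target space. -/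
def productHHS {ι : Type v} [Finite ι] {Y : ι → Type w} [∀ i, MetricSpace (Y i)]
    [∀ i, Nonempty (Y i)] (hY : ∀ i, IsHyperbolic 1 (Y i)) {Z : Type u} [MetricSpace Z]
    (hZ : IsQuasigeodesicSpace 1 Z) (f : Z → ∀ i, Y i)
    (hlip : ∃ K, ∀ i x y, dist (f x i) (f y i) ≤ K * dist x y)
    (hsurj : ∃ D, ∀ y : ∀ i, Y i, ∃ x, ∀ i, dist (f x i) (y i) ≤ D)
    (hproper : ∀ κ : ℝ, ∃ θ : ℝ, ∀ x y, θ ≤ dist x y → ∃ i, κ ≤ dist (f x i) (f y i)) :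
    HHSStructure.{u, v, w} Z where
  Index := ProductDomain ι
  C := Space Y
  Orth := ProductDomain.Orth
  proj V x := {coord (f x) V}
  rho _ _ := Set.univ
  rhoDown _ _ _ := Set.univ
  ξ := 0
  κ₀ := 0
  quasigeodesic := ⟨1, le_rfl, hZ⟩
  hyperbolic := ⟨1, fun W => match W with
    | factor i => hY i
    | multiple _ _ => isHyperbolic_of_subsingleton (Y := PUnit)⟩
  proj_nonempty _ _ := Set.singleton_nonempty _
  proj_diam W x := by
    rintro _ rfl _ rfl
    exact (dist_self _).le
  proj_lipschitz_onto := by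
    obtain ⟨K, hK⟩ := hlip
    obtain ⟨D, hD⟩ := hsurj
    obtain ⟨x₀, _⟩ := hD fun i => Classical.arbitrary (Y i)
    refine ⟨max (max K D) 0, fun W => ⟨fun x y => ?_, fun p => ?_⟩⟩
    · rw [setDist_singleton]
      have h0 : 0 ≤ max (max K D) 0 := le_max_right _ _
      obtain i | ⟨s, hs⟩ := W
      · have h1 : K ≤ max (max K D) 0 := (le_max_left _ _).trans (le_max_left _ _)
        exact (hK i x y).trans (by nlinarith [dist_nonneg (x := x) (y := y)])
      · refine (dist_eq_zero.2 rfl).le.trans ?_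
        positivity
    · obtain i | ⟨s, hs⟩ := W
      · have key (q : Y i) : ∃ x, dist q (f x i) ≤ D := by
          classical
          obtain ⟨x, hx⟩ := hD (Function.update (fun i => Classical.arbitrary (Y i)) i q)
          have := hx i
          rw [Function.update_self, dist_comm] at this
          exact ⟨x, this⟩
        obtain ⟨x, hx⟩ := key p
        exact ⟨x, _, rfl, hx.trans ((le_max_right _ _).trans (le_max_left _ _))⟩
      · exact ⟨x₀, _, rfl, (dist_eq_zero.2 rfl).le.trans (le_max_right _ _)⟩
  unique_maximal := by
    rcases isEmpty_or_nonempty ι with h | h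
    · exact Or.inl ⟨fun V => h.elim V.support_nonempty.some⟩
    · right
      obtain ⟨S, hS⟩ := exists_support_eq (Set.univ_nonempty (α := ι))
      have hle : ∀ V, V ≤ S := fun V => by rw [le_def, hS]; exact Set.subset_univ _
      exact ⟨S, fun V hV => (hle V).antisymm hV, fun S' hS' => (hS' S (hle S')).symm⟩
  rho_nonempty _ _ _ := Set.univ_nonempty
  rho_diam V W h := by
    have := subsingleton_space Y h
    exact diamLE_of_subsingleton _
  rhoDown_nonempty _ _ _ _ := Set.univ_nonempty
  orth_symm _ _ h := Disjoint.symm h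
  orth_irrefl V h := V.support_nonempty.ne_empty (disjoint_self.1 h)
  orth_of_le U V W h h' := Disjoint.mono_left h h'
  orth_not_le V W h :=
    ⟨fun h' => V.support_nonempty.ne_empty (disjoint_self.1 (Disjoint.mono_right h' h)),
      fun h' => W.support_nonempty.ne_empty (disjoint_self.1 (Disjoint.mono_left h' h))⟩
  orth_container T U hU := by
    rintro ⟨V₀, hV₀, h₀⟩
    have key : ∀ V ≤ T, Disjoint V.support U.support → V.support ⊆ T.support \ U.support :=
      fun V hV h => Set.subset_sdiff.2 ⟨hV, h⟩
    obtain ⟨W, hW⟩ := exists_support_eq (V₀.support_nonempty.mono (key V₀ hV₀ h₀))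
    refine ⟨W, ?_, fun V hV h => ?_⟩
    · rw [lt_def, hW]
      exact sdiff_lt hU U.support_nonempty.ne_empty
    · rw [le_def, hW]
      exact key V hV h
  consistency_transverse V W h x := by
    have := subsingleton_space Y (Or.inr h)
    exact Or.inl (setDist_of_subsingleton _ _).le
  consistency_nest V W h x := by
    have := subsingleton_space Y (Or.inl h)
    exact Or.inl (setDist_of_subsingleton _ _).le
  consistency_rho U V W _ h := by
    have := subsingleton_space Y (h.imp_right And.left)
    exact (setDist_of_subsingleton _ _).le
  finite_complexity := by
    have := Fintype.ofFinite (ProductDomain ι)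
    exact ⟨Fintype.card (ProductDomain ι), fun s _ => s.card_le_univ⟩
  large_links := by
    -- All properly nested domains are listed, there being finitely many domains.
    have := Fintype.ofFinite (ProductDomain ι)
    classical
    refine ⟨Fintype.card (ProductDomain ι) + 1, 0, by simp, le_rfl, le_rfl, fun W x x' =>
      ⟨Finset.univ.filter (· < W), ?_, fun U hU => ⟨(Finset.mem_filter.1 hU).2, ?_⟩, fun V hV =>
        Or.inl ⟨V, Finset.mem_filter.2 ⟨Finset.mem_univ _, hV⟩, le_rfl⟩⟩⟩
    · have h1 : ((Finset.univ.filter (· < W)).card : ℝ) ≤ Fintype.card (ProductDomain ι) := by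
        exact_mod_cast Finset.card_le_univ _
      have h2 : 0 ≤ (Fintype.card (ProductDomain ι) + 1 : ℝ) *
        setDist {coord (f x) W} {coord (f x') W} :=
          mul_nonneg (by positivity) (setDist_nonneg _ _)
      linarith
    · have := subsingleton_space Y (Or.inl (Finset.mem_filter.1 hU).2)
      rw [setDist_of_subsingleton, setDist_of_subsingleton]
      positivity
  bounded_geodesic_image := by
    refine ⟨1, one_pos, fun V W h p q γ _ => Or.inr ?_⟩
    refine ⟨γ 0, ⟨0, ⟨le_rfl, dist_nonneg⟩, rfl⟩, γ 0, trivial, ?_⟩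
    rw [dist_self]
    exact zero_le_one
  partial_realization := by
    obtain ⟨D, hD⟩ := hsurj
    refine ⟨max D 0, fun 𝒱 p _ _ => ?_⟩
    have key (q : ∀ i, factor i ∈ 𝒱 → Y i) : ∃ x, ∀ i h, dist (f x i) (q i h) ≤ D := by
      classical
      obtain ⟨x, hx⟩ := hD fun i =>
        if h : factor i ∈ 𝒱 then q i h else Classical.arbitrary (Y i)
      refine ⟨x, fun i h => ?_⟩
      have := hx i
      rwa [dif_pos h] at this
    obtain ⟨x, hx⟩ := key fun i h => p ⟨factor i, h⟩
    refine ⟨x, fun V => ⟨?_, fun W hW => ?_⟩⟩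
    · rw [setDist_singleton]
      obtain ⟨i | ⟨s, hs⟩, hV⟩ := V
      · exact (hx i hV).trans (le_max_left _ _)
      · exact (dist_eq_zero.2 rfl).le.trans (le_max_right _ _)
    · have := subsingleton_space Y (hW.imp_right transverse_comm.1)
      rw [setDist_of_subsingleton]
      exact le_max_right _ _
  uniqueness κ _ := by
    obtain ⟨θ, hθ⟩ := hproper κ
    refine ⟨θ, fun x y h => ?_⟩
    obtain ⟨i, hi⟩ := hθ x y h
    exact ⟨factor i, by rw [setDist_singleton]; exact hi⟩

/-! ### Cayley graphs and the Milnor–Schwarz lemma -/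

theorem dist_getVert_of_length_eq_dist {V : Type u} {G : SimpleGraph V} (hG : G.Connected)
    {x y : V} {p : G.Walk x y} (hp : p.length = G.dist x y) {i j : ℕ} (hij : i ≤ j)
    (hj : j ≤ p.length) : G.dist (p.getVert i) (p.getVert j) = j - i := by
  have h1 := SimpleGraph.dist_le (p.take i)
  have h2 := SimpleGraph.dist_le (p.drop j)
  have h3 := SimpleGraph.dist_le (((p.drop i).take (j - i)).copy rfl
    (by rw [SimpleGraph.Walk.drop_getVert, Nat.add_sub_cancel' hij]))
  have h4 := hG.dist_triangle (u := x) (v := p.getVert i) (w := p.getVert j)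
  have h5 := hG.dist_triangle (u := x) (v := p.getVert j) (w := y)
  rw [SimpleGraph.Walk.length_copy] at h3
  rw [SimpleGraph.Walk.take_length] at h1 h3
  rw [SimpleGraph.Walk.drop_length] at h2
  omega

theorem isQuasigeodesicSpace_cayley {G : Type u} [Group G] (A : Set G)
    (hA : Subgroup.closure A = ⊤) : IsQuasigeodesicSpace 1 (Cayley A hA) := by
  intro (x : G) (y : G)
  obtain ⟨p, hp⟩ := (mulCayley_connected A hA).exists_walk_length_eq_dist x y
  refine ⟨p.length, fun t => p.getVert ⌊t⌋₊, by positivity, ?_, ?_, ?_⟩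
  · simp only [Nat.floor_zero, p.getVert_zero]; rfl
  · simp only [Nat.floor_natCast, p.getVert_length]; rfl
  have key' : ∀ s ∈ Set.Icc (0 : ℝ) p.length, ∀ t ∈ Set.Icc (0 : ℝ) p.length, s ≤ t →
      t - s - 1 ≤ ((SimpleGraph.mulCayley A).dist (p.getVert ⌊s⌋₊) (p.getVert ⌊t⌋₊) : ℝ) ∧
      ((SimpleGraph.mulCayley A).dist (p.getVert ⌊s⌋₊) (p.getVert ⌊t⌋₊) : ℝ) ≤ t - s + 1 := by
    intro s hs t ht hst
    have h1 : ⌊s⌋₊ ≤ ⌊t⌋₊ := Nat.floor_mono hst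
    have h2 : ⌊t⌋₊ ≤ p.length := Nat.floor_le_of_le ht.2
    rw [dist_getVert_of_length_eq_dist (mulCayley_connected A hA) hp h1 h2, Nat.cast_sub h1]
    have := Nat.floor_le hs.1
    have := Nat.floor_le ht.1
    have := Nat.lt_floor_add_one s
    have := Nat.lt_floor_add_one t
    constructor <;> linarith
  intro s hs t ht
  change |s - t| / 1 - 1 ≤
      ((SimpleGraph.mulCayley A).dist (p.getVert ⌊s⌋₊) (p.getVert ⌊t⌋₊) : ℝ) ∧
    ((SimpleGraph.mulCayley A).dist (p.getVert ⌊s⌋₊) (p.getVert ⌊t⌋₊) : ℝ) ≤ 1 * |s - t| + 1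
  rcases le_total s t with h | h
  · rw [abs_sub_comm, abs_of_nonneg (sub_nonneg.2 h), div_one, one_mul]
    exact key' s hs t ht h
  · rw [abs_of_nonneg (sub_nonneg.2 h), div_one, one_mul, SimpleGraph.dist_comm]
    exact key' t ht s hs h

section MilnorSchwarz

variable {ι : Type v} {G : Type u} [Group G] {Y : ι → Type w} [∀ i, MetricSpace (Y i)]
  (φ : ∀ i, G →* (Y i ≃ᵢ Y i)) (y₀ : ∀ i, Y i)

/-- The elements of `G` that move each coordinate of the base point by at most `R`. -/
def shortElements (R : ℝ) : Set G := {g | ∀ i, dist (φ i g (y₀ i)) (y₀ i) ≤ R}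

theorem dist_map_inv_mul (i : ι) (g h : G) (y : Y i) :
    dist (φ i (g⁻¹ * h) y) y = dist (φ i g y) (φ i h y) := by
  have : φ i h y = φ i g (φ i (g⁻¹ * h) y) := by
    rw [← IsometryEquiv.mul_apply, ← map_mul, mul_inv_cancel_left]
  rw [this, (φ i g).dist_eq, dist_comm]

variable {φ y₀}

/-- Subdividing geodesics in all factors simultaneously, and approximating the points of the
subdivision by the orbit of the base point, two group elements are joined by a chain with short
steps. -/
theorem exists_chain (hY : ∀ i, IsGeodesicSpace (Y i)) {D : ℝ}
    (hD : ∀ y : ∀ i, Y i, ∃ g, ∀ i, dist (φ i g (y₀ i)) (y i) ≤ D) (g h : G) {N : ℕ} (hN0 : 0 < N)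
    (hN : ∀ i, dist (φ i g (y₀ i)) (φ i h (y₀ i)) ≤ N) :
    ∃ s : ℕ → G, s 0 = g ∧ s N = h ∧
      ∀ k < N, (s k)⁻¹ * s (k + 1) ∈ shortElements φ y₀ (2 * D + 1) := by
  choose γ hγ using fun i => hY i (φ i g (y₀ i)) (φ i h (y₀ i))
  choose t ht using fun k : ℕ => hD fun i =>
    γ i (k / N * dist (φ i g (y₀ i)) (φ i h (y₀ i)))
  have hN1 : (0 : ℝ) < N := Nat.cast_pos.2 hN0
  refine ⟨fun k => if k = 0 then g else if k = N then h else t k, by simp, by simp [hN0.ne'], ?_⟩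
  have key : ∀ k ≤ N, ∀ i,
      dist (φ i (if k = 0 then g else if k = N then h else t k) (y₀ i))
        (γ i (k / N * dist (φ i g (y₀ i)) (φ i h (y₀ i)))) ≤ D := by
    intro k _ i
    have hD0 : 0 ≤ D := dist_nonneg.trans (ht 0 i)
    split_ifs with h1 h2
    · rw [h1, Nat.cast_zero, zero_div, zero_mul, (hγ i).1, dist_self]
      exact hD0
    · rw [h2, div_self hN1.ne', one_mul, (hγ i).2.1, dist_self]
      exact hD0
    · exact ht k i
  have hmem : ∀ k ≤ N, ∀ i, (k / N * dist (φ i g (y₀ i)) (φ i h (y₀ i)) : ℝ) ∈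
      Set.Icc 0 (dist (φ i g (y₀ i)) (φ i h (y₀ i))) := fun k hk i =>
    ⟨by positivity, mul_le_of_le_one_left dist_nonneg
      ((div_le_one hN1).2 (Nat.cast_le.2 hk))⟩
  intro k hk i
  rw [dist_map_inv_mul]
  refine (dist_triangle4_right _ _ _ _).trans ((add_le_add_three (key k hk.le i) (key (k + 1) hk i)
    ?_).trans (show D + D + 1 ≤ 2 * D + 1 by linarith))
  rw [(hγ i).2.2 _ (hmem k hk.le i) _ (hmem (k + 1) hk i), ← sub_mul, abs_mul, abs_dist]
  have : |(k / N - (k + 1 : ℕ) / N : ℝ)| = 1 / N := by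
    rw [← sub_div, abs_div, Nat.abs_cast]
    simp
  rw [this, div_mul_eq_mul_div, one_mul, div_le_one hN1]
  exact hN i

theorem closure_shortElements_eq_top [Finite ι] (hY : ∀ i, IsGeodesicSpace (Y i)) {D : ℝ}
    (hD : ∀ y : ∀ i, Y i, ∃ g, ∀ i, dist (φ i g (y₀ i)) (y i) ≤ D) :
    Subgroup.closure (shortElements φ y₀ (2 * D + 1)) = ⊤ := by
  refine eq_top_iff.2 fun g _ => ?_
  obtain ⟨R, hR⟩ := (Set.finite_range fun i => dist (φ i 1 (y₀ i)) (φ i g (y₀ i))).bddAbove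
  obtain ⟨s, h0, h1, hs⟩ := exists_chain hY hD 1 g (Nat.succ_pos ⌈R⌉₊) fun i =>
    (hR ⟨i, rfl⟩).trans ((Nat.le_ceil R).trans (Nat.cast_le.2 (Nat.le_succ _)))
  have key : ∀ k ≤ ⌈R⌉₊ + 1, s k ∈ Subgroup.closure (shortElements φ y₀ (2 * D + 1)) := by
    intro k
    induction k with
    | zero => intro _; rw [h0]; exact one_mem _
    | succ k ih =>
      intro hk
      have := mul_mem (ih (Nat.le_of_succ_le hk)) (Subgroup.subset_closure (hs k hk))
      rwa [mul_inv_cancel_left] at this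
  rw [← h1]
  exact key _ le_rfl

theorem mulCayley_dist_le (hY : ∀ i, IsGeodesicSpace (Y i)) {D : ℝ}
    (hD : ∀ y : ∀ i, Y i, ∃ g, ∀ i, dist (φ i g (y₀ i)) (y i) ≤ D)
    (hc : (SimpleGraph.mulCayley (shortElements φ y₀ (2 * D + 1))).Connected) (g h : G) {N : ℕ}
    (hN0 : 0 < N) (hN : ∀ i, dist (φ i g (y₀ i)) (φ i h (y₀ i)) ≤ N) :
    (SimpleGraph.mulCayley (shortElements φ y₀ (2 * D + 1))).dist g h ≤ N := by
  obtain ⟨s, h0, h1, hs⟩ := exists_chain hY hD g h hN0 hN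
  have key : ∀ k ≤ N,
      (SimpleGraph.mulCayley (shortElements φ y₀ (2 * D + 1))).dist g (s k) ≤ k := by
    intro k
    induction k with
    | zero => intro _; rw [h0, SimpleGraph.dist_self]
    | succ k ih =>
      intro hk
      refine hc.dist_triangle.trans (add_le_add (ih (Nat.le_of_succ_le hk)) ?_)
      by_cases e : s k = s (k + 1)
      · rw [← e, SimpleGraph.dist_self]
        exact zero_le_one
      · exact (SimpleGraph.dist_eq_one_iff_adj.2
          ((SimpleGraph.mulCayley_adj _ _ _).2 ⟨e, Or.inl (hs k hk)⟩)).le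
  rw [← h1]
  exact key N le_rfl

theorem dist_orbit_le {R : ℝ} (hc : (SimpleGraph.mulCayley (shortElements φ y₀ R)).Connected)
    (i : ι) (g h : G) : dist (φ i g (y₀ i)) (φ i h (y₀ i)) ≤
      R * (SimpleGraph.mulCayley (shortElements φ y₀ R)).dist g h := by
  obtain ⟨p, hp⟩ := hc.exists_walk_length_eq_dist g h
  rw [← hp]
  clear hp
  induction p with
  | nil => simp
  | cons hadj p ih =>
    rw [SimpleGraph.Walk.length_cons, Nat.cast_succ, mul_add, mul_one, add_comm]
    refine (dist_triangle _ _ _).trans (add_le_add ?_ ih)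
    rcases ((SimpleGraph.mulCayley_adj _ _ _).1 hadj).2 with h | h
    · rw [← dist_map_inv_mul]; exact h i
    · rw [dist_comm, ← dist_map_inv_mul]; exact h i

end MilnorSchwarz

/-! ### The hierarchically hyperbolic group structure -/

namespace ProductDomain

variable {ι : Type v} {G : Type u} [Group G] {Y : ι → Type w} [∀ i, MetricSpace (Y i)]
  (φ : ∀ i, G →* (Y i ≃ᵢ Y i))

/-- The action of a group element on the hyperbolic space of a domain. -/
def isometry (g : G) : ∀ V : ProductDomain ι, Space Y V ≃ᵢ Space Y V
  | factor i => φ i g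
  | multiple _ _ => IsometryEquiv.refl PUnit

theorem isometry_mul (g h : G) : ∀ (V : ProductDomain ι) (p : Space Y V),
    isometry φ (g * h) V p = isometry φ g V (isometry φ h V p)
  | factor i, p => DFunLike.congr_fun (map_mul (φ i) g h) p
  | multiple _ _, _ => rfl

theorem isometry_coord (y₀ : ∀ i, Y i) (g h : G) : ∀ V : ProductDomain ι,
    isometry φ g V (coord (fun i => φ i h (y₀ i)) V) = coord (fun i => φ i (g * h) (y₀ i)) V
  | factor i => (DFunLike.congr_fun (map_mul (φ i) g h) (y₀ i)).symm
  | multiple _ _ => rfl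

theorem isometry_image_univ (g : G) (V : ProductDomain ι) :
    isometry φ g V '' Set.univ = Set.univ :=
  Set.image_univ_of_surjective (isometry φ g V).surjective

end ProductDomain

section

variable {ι : Type v} [Finite ι] {G : Type u} [Group G] {Y : ι → Type w} [∀ i, MetricSpace (Y i)]
  (hY : ∀ i, IsHyperbolic 1 (Y i)) (φ : ∀ i, G →* (Y i ≃ᵢ Y i)) (y₀ : ∀ i, Y i) (D : ℝ)
  (hD : ∀ y : ∀ i, Y i, ∃ g, ∀ i, dist (φ i g (y₀ i)) (y i) ≤ D)

/-- The hierarchically hyperbolic structure on a Cayley graph of a group acting coboundedly on a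
product of hyperbolic spaces. -/
def orbitHHS : HHSStructure.{u, v, w} (Cayley (shortElements φ y₀ (2 * D + 1))
    (closure_shortElements_eq_top (fun i => (hY i).1) hD)) :=
  have hc := mulCayley_connected _ (closure_shortElements_eq_top (fun i => (hY i).1) hD)
  have : ∀ i, Nonempty (Y i) := fun i => ⟨y₀ i⟩
  productHHS hY (isQuasigeodesicSpace_cayley _ _) (fun (g : G) i => φ i g (y₀ i))
    ⟨2 * D + 1, fun i g h => dist_orbit_le hc i g h⟩ ⟨D, hD⟩ (by
      intro κ
      refine ⟨⌈κ⌉₊ + 2, fun (g : G) (h : G) hgh => ?_⟩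
      by_contra! hlt
      have := mulCayley_dist_le (fun i => (hY i).1) hD hc g h (Nat.succ_pos ⌈κ⌉₊) fun i =>
        (hlt i).le.trans ((Nat.le_ceil κ).trans (Nat.cast_le.2 (Nat.le_succ _)))
      have h2 : (⌈κ⌉₊ + 2 : ℝ) ≤ ((⌈κ⌉₊ + 1 : ℕ) : ℝ) := hgh.trans (Nat.cast_le.2 this)
      push_cast at h2
      linarith)

/-- The hierarchically hyperbolic group structure on a group which acts on finitely many hyperbolic
spaces, properly and coboundedly on their product, with trivial action on the domains. -/
def productHHG (hfin : ∀ R, (shortElements φ y₀ R).Finite) : HHGStructure.{u, v, w} G where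
  gens := shortElements φ y₀ (2 * D + 1)
  gens_finite := hfin _
  gens_generate := closure_shortElements_eq_top (fun i => (hY i).1) hD
  hhs := orbitHHS hY φ y₀ D hD
  action :=
    { smul := fun _ V => V
      one_smul := fun _ => rfl
      mul_smul := fun _ _ _ => rfl }
  cofinite := @Quotient.finite _ (inferInstanceAs (Finite (ProductDomain ι))) _
  smul_le_iff _ _ _ := Iff.rfl
  smul_orth_iff _ _ _ := Iff.rfl
  isom := ProductDomain.isometry φ
  isom_mul g h U p := heq_of_eq (ProductDomain.isometry_mul φ g h U p)
  proj_equivariant g x U :=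
    Set.image_singleton.trans (congrArg Singleton.singleton
      (ProductDomain.isometry_coord φ y₀ g x U))
  rho_equivariant g _ U _ := ProductDomain.isometry_image_univ φ g U

end

/-! ### Discrete groups of isometries -/

open Topology in
/-- On the isometry group, uniform convergence on compacta is pointwise convergence. -/
theorem exists_finset_of_mem_nhds_one {Y : Type u} [MetricSpace Y] {U : Set (Y ≃ᵢ Y)}
    (hU : U ∈ 𝓝 (1 : Y ≃ᵢ Y)) :
    ∃ F : Finset Y, ∃ ε > 0, ∀ f : Y ≃ᵢ Y, (∀ x ∈ F, dist (f x) x < ε) → f ∈ U := by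
  rw [nhds_induced, Filter.mem_comap] at hU
  obtain ⟨V, hV, hVU⟩ := hU
  obtain ⟨⟨K, ε⟩, ⟨hK, hε⟩, hKV⟩ := (nhds_basis_uniformity'
    (Metric.uniformity_basis_dist.compactConvergenceUniformity (α := Y))).mem_iff.1 hV
  have hε : 0 < ε := hε
  -- Isometries which move the points of an `ε / 3`-net of `K` by less than `ε / 3` move the points
  -- of `K` by less than `ε`.
  obtain ⟨F, -, hF, hKF⟩ := hK.finite_cover_balls (e := ε / 3) (by positivity)
  refine ⟨hF.toFinset, ε / 3, by positivity, fun f hf => hVU (hKV fun x hx => ?_)⟩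
  obtain ⟨y, hy, hxy⟩ := Set.mem_iUnion₂.1 (hKF hx)
  have h1 := hf y (hF.mem_toFinset.2 hy)
  have h2 : dist x y < ε / 3 := hxy
  have h3 := f.dist_eq x y
  change dist x (f x) < ε
  calc dist x (f x) ≤ dist x y + dist y (f y) + dist (f y) (f x) := dist_triangle4 _ _ _ _
    _ < ε := by rw [dist_comm y, dist_comm (f y) (f x), h3]; linarith

/-- Pigeonhole principle for bounded sequences. -/
theorem exists_ne_dist_lt_of_infinite {α : Type v} {Z : Type w} [PseudoMetricSpace Z]
    [ProperSpace Z] {s : Set α} (hs : s.Infinite) {f : α → Z} (hf : Bornology.IsBounded (f '' s))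
    {ε : ℝ} (hε : 0 < ε) : ∃ a ∈ s, ∃ b ∈ s, a ≠ b ∧ dist (f a) (f b) < ε := by
  obtain ⟨F, -, hF, hc⟩ := hf.isCompact_closure.finite_cover_balls (half_pos hε)
  have hnear : ∀ a ∈ s, ∃ z ∈ F, dist (f a) z < ε / 2 := fun a ha => by
    simpa using hc (subset_closure ⟨a, ha, rfl⟩)
  have : Nonempty Z := ⟨f hs.nonempty.some⟩
  choose! c hcF hc using hnear
  obtain ⟨a, ha, b, hb, hab, e⟩ := hs.exists_ne_map_eq_of_mapsTo hcF hF
  refine ⟨a, ha, b, hb, hab, ?_⟩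
  have h1 := hc a ha
  have h2 := hc b hb
  rw [← e] at h2
  linarith [dist_triangle_right (f a) (f b) (c a)]

open Topology in
/-- A discrete group acts properly: only finitely many elements move a given base point by a given
amount. If there were infinitely many, then two of them would be close on any given finite set, and
their quotient would be a non-trivial element close to the identity. -/
theorem finite_of_discrete {n m : ℕ} {X : Fin m → Type u} [∀ i, MetricSpace (X i)]
    [∀ i, ProperSpace (X i)] (Γ : Subgroup (FactorIsom n X)) [DiscreteTopology Γ]
    (a : EuclideanSpace ℝ (Fin n)) (b : ∀ i, X i) (R : ℝ) :
    {g : Γ | dist (g.1.1 a) a ≤ R ∧ ∀ i, dist (g.1.2 i (b i)) (b i) ≤ R}.Finite := by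
  have h1 : ({1} : Set Γ) ∈ 𝓝 (1 : Γ) := (isOpen_discrete _).mem_nhds rfl
  rw [nhds_subtype_eq_comap, Filter.mem_comap] at h1
  obtain ⟨U, hU, hU1⟩ := h1
  rw [show ((1 : Γ) : FactorIsom n X) = (1, 1) from rfl, nhds_prod_eq, Filter.mem_prod_iff] at hU
  obtain ⟨V, hV, W, hW, hVW⟩ := hU
  rw [nhds_pi, Filter.mem_pi'] at hW
  obtain ⟨I, t, ht, htW⟩ := hW
  obtain ⟨F, ε, hε, hF⟩ := exists_finset_of_mem_nhds_one hV
  choose F' ε' hε' hF' using fun i => exists_finset_of_mem_nhds_one (ht i)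
  obtain ⟨δ, hδ, hδε⟩ : ∃ δ > 0, δ ≤ ε ∧ ∀ i, δ ≤ ε' i := by
    have h : ∀ᶠ δ in 𝓝[>] (0 : ℝ), 0 < δ ∧ δ ≤ ε ∧ ∀ i, δ ≤ ε' i :=
      Filter.Eventually.and self_mem_nhdsWithin (Filter.Eventually.and
        (Filter.mem_of_superset (Ioc_mem_nhdsGT hε) fun _ h => h.2)
        (Filter.eventually_all.2 fun i =>
          Filter.mem_of_superset (Ioc_mem_nhdsGT (hε' i)) fun _ h => h.2))
    exact h.exists
  by_contra hinf
  let f : Γ → (F → EuclideanSpace ℝ (Fin n)) × (∀ i, F' i → X i) :=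
    fun g => (fun x => g.1.1 x, fun i x => g.1.2 i x)
  have hf : Bornology.IsBounded (f '' {g : Γ | dist (g.1.1 a) a ≤ R ∧
      ∀ i, dist (g.1.2 i (b i)) (b i) ≤ R}) := by
    refine ((Bornology.IsBounded.pi fun x : F =>
      Metric.isBounded_closedBall (x := a) (r := dist x.1 a + R)).prod
      (Bornology.IsBounded.pi fun i => Bornology.IsBounded.pi fun x : F' i =>
        Metric.isBounded_closedBall (x := b i) (r := dist x.1 (b i) + R))).subset ?_
    rintro _ ⟨g, hg, rfl⟩
    refine ⟨fun x _ => ?_, fun i _ x _ => ?_⟩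
    · exact (dist_triangle _ (g.1.1 a) _).trans
        (add_le_add (g.1.1.dist_eq _ _).le hg.1)
    · exact (dist_triangle _ (g.1.2 i (b i)) _).trans
        (add_le_add ((g.1.2 i).dist_eq _ _).le (hg.2 i))
  obtain ⟨g, hg, h, hh, hgh, hd⟩ := exists_ne_dist_lt_of_infinite hinf hf hδ
  rw [Prod.dist_eq, max_lt_iff, dist_pi_lt_iff hδ, dist_pi_lt_iff hδ] at hd
  refine hgh (inv_mul_eq_one.1 (hU1 (hVW ⟨hF _ fun x hx => ?_,
    htW fun i _ => hF' i _ fun x hx => ?_⟩)))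
  · refine lt_of_eq_of_lt ?_ ((hd.1 ⟨x, hx⟩).trans_le hδε.1)
    rw [← g.1.1.dist_eq, dist_comm]
    congr 1
    exact g.1.1.apply_symm_apply _
  · refine lt_of_eq_of_lt ?_ (((dist_pi_lt_iff hδ).1 (hd.2 i) ⟨x, hx⟩).trans_le (hδε.2 i))
    rw [← (g.1.2 i).dist_eq, dist_comm]
    congr 1
    exact (g.1.2 i).apply_symm_apply _

/-! ### The factors of the product space -/

theorem apply_eq_add_of_linearPart_eq_one {n : ℕ}
    {f : EuclideanSpace ℝ (Fin n) ≃ᵢ EuclideanSpace ℝ (Fin n)} (hf : linearPart n f = 1)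
    (v : EuclideanSpace ℝ (Fin n)) : f v = v + f 0 := by
  have h := AffineIsometryEquiv.map_vsub f.toRealAffineIsometryEquiv v 0
  have h1 : f.toRealAffineIsometryEquiv.linearIsometryEquiv = 1 := hf
  rw [h1] at h
  simp only [vsub_eq_sub, sub_zero, IsometryEquiv.coeFn_toRealAffineIsometryEquiv] at h
  exact sub_eq_iff_eq_add.1 h.symm

/-- The hyperbolic factors: a copy of `ℝ` for each Euclidean coordinate, and the spaces `X i`. -/
def Factor (n : ℕ) {m : ℕ} (X : Fin m → Type u) : Fin n ⊕ Fin m → Type u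
  | Sum.inl _ => ULift ℝ
  | Sum.inr i => X i

section

variable {n m : ℕ} {X : Fin m → Type u} [∀ i, MetricSpace (X i)]

instance : ∀ k, MetricSpace (Factor n X k)
  | Sum.inl _ => inferInstanceAs (MetricSpace (ULift ℝ))
  | Sum.inr i => inferInstanceAs (MetricSpace (X i))

/-- The coordinates of a point in the hyperbolic factors. -/
def factorCoord (x : ProdSpace n X) : ∀ k, Factor n X k
  | Sum.inl j => ULift.up (x.fst j)
  | Sum.inr i => x.snd i

def realIsometry : ℝ ≃ᵢ ULift.{u} ℝ where
  toEquiv := Equiv.ulift.symm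
  isometry_toFun := Isometry.of_dist_eq fun _ _ => rfl

/-- A group acting on `𝔼ⁿ` by translations acts on each coordinate by translations, and on each
`X i` by projection. -/
def factorAction (Γ : Subgroup (FactorIsom n X)) (hΓ : ∀ g ∈ Γ, linearPart n g.1 = 1) :
    ∀ k, Γ →* (Factor n X k ≃ᵢ Factor n X k)
  | Sum.inl j =>
    { toFun := fun g =>
        (realIsometry.symm.trans (IsometryEquiv.addRight ((g.1.1 0) j))).trans realIsometry
      map_one' := by
        ext t
        exact ULift.down_injective (add_zero t.down)
      map_mul' := fun g h => by
        ext t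
        refine ULift.down_injective ?_
        change t.down + g.1.1 (h.1.1 0) j = t.down + h.1.1 0 j + g.1.1 0 j
        rw [apply_eq_add_of_linearPart_eq_one (hΓ g g.2) (h.1.1 0), add_assoc]
        rfl }
  | Sum.inr i => ((Pi.evalMonoidHom _ i).comp (MonoidHom.snd _ _)).comp Γ.subtype

theorem factorAction_factorCoord {Γ : Subgroup (FactorIsom n X)}
    (hΓ : ∀ g ∈ Γ, linearPart n g.1 = 1) (g : Γ) (x : ProdSpace n X) :
    ∀ k, factorAction Γ hΓ k g (factorCoord x k) = factorCoord (act g.1 x) k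
  | Sum.inl j => by
    change ULift.up (x.fst j + g.1.1 0 j) = ULift.up (g.1.1 x.fst j)
    rw [apply_eq_add_of_linearPart_eq_one (hΓ g g.2) x.fst]
    rfl
  | Sum.inr i => rfl

theorem dist_factorCoord_le (x y : ProdSpace n X) : ∀ k : Fin n ⊕ Fin m,
    dist (factorCoord x k) (factorCoord y k) ≤ dist x y
  | Sum.inl j => by
    refine le_trans ?_ (WithLp.dist_fst_le (p := 2) x y)
    exact PiLp.dist_apply_le x.fst y.fst j
  | Sum.inr i => by
    refine le_trans ?_ (WithLp.dist_snd_le (p := 2) x y)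
    exact PiLp.dist_apply_le x.snd y.snd i

theorem exists_factorCoord_eq (y : ∀ k, Factor n X k) : ∃ x : ProdSpace n X, factorCoord x = y := by
  refine ⟨WithLp.toLp 2 (WithLp.toLp 2 fun j => (show ULift ℝ from y (Sum.inl j)).down,
    WithLp.toLp 2 fun i => y (Sum.inr i)), ?_⟩
  ext (j | i)
  · rfl
  · rfl

theorem isHyperbolic_factor (hX : ∀ i, IsCATNegOne (X i)) : ∀ k, IsHyperbolic 1 (Factor n X k)
  | Sum.inl _ => isHyperbolic_real
  | Sum.inr i => (hX i).isHyperbolic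

theorem exists_dist_factorAction_le {Γ : Subgroup (FactorIsom n X)}
    (hΓ : ∀ g ∈ Γ, linearPart n g.1 = 1) (hc : ActsCocompactly Γ) (x₀ : ProdSpace n X) :
    ∃ D, ∀ y : ∀ k, Factor n X k, ∃ g : Γ,
      ∀ k, dist (factorAction Γ hΓ k g (factorCoord x₀ k)) (y k) ≤ D := by
  obtain ⟨K, hK, hcov⟩ := hc
  obtain ⟨D, hD⟩ := hK.isBounded.subset_closedBall x₀
  refine ⟨D, fun y => ?_⟩
  obtain ⟨x, rfl⟩ := exists_factorCoord_eq y
  obtain ⟨g, hg, k, hk, rfl⟩ := hcov x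
  refine ⟨⟨g, hg⟩, fun l => ?_⟩
  rw [← factorAction_factorCoord hΓ ⟨g, hg⟩ k, IsometryEquiv.dist_eq]
  refine (dist_factorCoord_le _ _ _).trans ?_
  rw [dist_comm]
  exact hD hk

theorem finite_shortElements [∀ i, ProperSpace (X i)] {Γ : Subgroup (FactorIsom n X)}
    [DiscreteTopology Γ] (hΓ : ∀ g ∈ Γ, linearPart n g.1 = 1) (x₀ : ProdSpace n X) (R : ℝ) :
    (shortElements (factorAction Γ hΓ) (factorCoord x₀) R).Finite := by
  refine (finite_of_discrete Γ x₀.fst x₀.snd (max R (√(n * R ^ 2)))).subset fun g hg =>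
    ⟨?_, fun i => (hg (Sum.inr i)).trans (le_max_left _ _)⟩
  refine le_trans ?_ (le_max_right _ _)
  rw [EuclideanSpace.dist_eq]
  refine Real.sqrt_le_sqrt ?_
  calc ∑ j, dist (g.1.1 x₀.fst j) (x₀.fst j) ^ 2 ≤ ∑ _j : Fin n, R ^ 2 := by
        refine Finset.sum_le_sum fun j _ => pow_le_pow_left₀ dist_nonneg ?_ 2
        have := hg (Sum.inl j)
        rwa [factorAction_factorCoord] at this
    _ = n * R ^ 2 := by simp

end

end HHG

end

theorem theorem1 {n m : ℕ} (X : Fin m → Type u) [∀ i, MetricSpace (X i)]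
    [∀ i, ProperSpace (X i)]
    (hcat : ∀ i, HHG.IsCATNegOne (X i))
    (hirr : ∀ i, HHG.IsIrreducible (X i))
    (hne : ∀ i, HHG.IsNonElementary (X i))
    (H : Subgroup (HHG.FactorIsom n X)) (hclosed : IsClosed (H : Set (HHG.FactorIsom n X)))
    (hmin : HHG.ActsMinimally H) (hcoc : HHG.ActsCocompactly H)
    (Γ : Subgroup (HHG.FactorIsom n X)) (hΓ : HHG.IsUniformLattice Γ H)
    (hO : Γ.map (HHG.projO n X) = ⊥) :
    ∃ S : HHG.HHGStructure.{u, 0, u} Γ, HHG.IsProductStructure S := by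
  have := hΓ.discrete
  have hlin : ∀ g ∈ Γ, HHG.linearPart n g.1 = 1 := fun g hg =>
    (Subgroup.map_eq_bot_iff _).1 hO hg
  let x₀ : HHG.ProdSpace n X := WithLp.toLp 2 (0, WithLp.toLp 2 fun i => (hne i).choose 0 0)
  obtain ⟨D, hD⟩ := HHG.exists_dist_factorAction_le hlin hΓ.cocompact x₀
  refine ⟨HHG.productHHG (HHG.isHyperbolic_factor hcat) (HHG.factorAction Γ hlin)
    (HHG.factorCoord x₀) D hD (HHG.finite_shortElements hlin x₀), HHG.ProductDomain.factor, x₀,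
    fun _ => HHG.realIsometry, fun i => IsometryEquiv.refl (X i), ?_, ?_, ?_, fun _ _ => rfl,
    fun _ _ _ => HEq.rfl, fun _ _ _ => HEq.rfl, fun g j => ?_, fun _ _ => rfl⟩
  · intro k l h
    exact HHG.ProductDomain.factor.inj h
  · intro k l h
    exact Set.disjoint_singleton.2 h
  · rintro (k | ⟨s, hs⟩) hU
    · exact absurd ⟨k, rfl⟩ hU
    · exact ⟨PUnit.unit, fun _ => rfl⟩
  · exact congrArg Singleton.singleton (HHG.factorAction_factorCoord hlin g x₀ (Sum.inl j))
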